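/- Let $n \ge 0$ be an integer and let $M_n$ be the algebra of complex $n\times n$ matrices with the operator norm and its canonical operator space structure, i.e. $M_k(M_n)\cong M_{kn}$ carries the operator norm for every $k$. Let $V$ be an operator space, i.e. a complex normed space together with norms on all the matrix spaces $M_k(V)$, extending the norm of $V=M_1(V)$ and satisfying Ruan's axioms $\|\alpha v\beta\|\le\|\alpha\|\,\|v\|\,\|\beta\|$ (for $v\in M_k(V)$ and scalar matrices $\alpha\in M_{l,k}$, $\beta\in M_{k,l}$) and $\|v\oplus w\|=\max(\|v\|,\|w\|)$ (for $v\in M_k(V)$, $w\in M_l(V)$). Then every linear map $\Phi:M_n\to V$, not assumed to be positive in any sense, is completely bounded, and $$\|\Phi\|_{cb}\le n\,\|\Phi\|,$$ where $\|\Phi\|$ is the operator norm of $\Phi$, $\|\Phi\|_{cb}=\sup_{k\in\mathbb N}\|\Phi_k\|$, and $\Phi_k:M_k(M_n)\to M_k(V)$, $[x_{ij}]\mapsto[\Phi(x_{ij})]$, is the $k$-th amplification of $\Phi$. -/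

import Mathlib

open scoped Matrix ENNReal Matrix.Norms.L2Operator

noncomputable section

/-- The bimodule product `α v β` of a matrix `v` over a complex vector space `V` with scalar matrices
`α` and `β` on either side: `(α v β) i j = ∑ p q, α i p * β q j • v p q`. -/
def scalarSandwich {V : Type*} [AddCommGroup V] [Module ℂ V] {k l : ℕ}
    (α : Matrix (Fin l) (Fin k) ℂ) (v : Matrix (Fin k) (Fin k) V)
    (β : Matrix (Fin k) (Fin l) ℂ) : Matrix (Fin l) (Fin l) V :=
  Matrix.of fun i j => ∑ p, ∑ q, (α i p * β q j) • v p q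

/-- The block-diagonal direct sum `v ⊕ w ∈ M_{k+l}(V)` of `v ∈ M_k(V)` and `w ∈ M_l(V)`. -/
def matrixDirectSum {V : Type*} [Zero V] {k l : ℕ}
    (v : Matrix (Fin k) (Fin k) V) (w : Matrix (Fin l) (Fin l) V) :
    Matrix (Fin (k + l)) (Fin (k + l)) V :=
  Matrix.reindex finSumFinEquiv finSumFinEquiv (Matrix.fromBlocks v 0 0 w)

/-- An (abstract) operator space: a complex normed space `V` with a norm on every matrix space
`M_k(V)`, extending the norm of `V = M_1(V)` and satisfying Ruan's axioms
`‖α v β‖ ≤ ‖α‖ ‖v‖ ‖β‖` for scalar matrices `α`, `β` (with their operator norms) and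
`‖v ⊕ w‖ = max ‖v‖ ‖w‖`. By Ruan's theorem these are, up to complete isometry, the linear subspaces
of the algebras `B(H)`, with the norms of `M_k(B(H)) = B(H^k)`. Completeness is not required. -/
class OperatorSpace (V : Type*) [NormedAddCommGroup V] [NormedSpace ℂ V] where
  matNorm : ∀ k : ℕ, Matrix (Fin k) (Fin k) V → ℝ
  matNorm_add_le : ∀ (k : ℕ) (v w : Matrix (Fin k) (Fin k) V),
    matNorm k (v + w) ≤ matNorm k v + matNorm k w
  matNorm_smul : ∀ (k : ℕ) (c : ℂ) (v : Matrix (Fin k) (Fin k) V),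
    matNorm k (c • v) = ‖c‖ * matNorm k v
  eq_zero_of_matNorm_eq_zero : ∀ (k : ℕ) (v : Matrix (Fin k) (Fin k) V),
    matNorm k v = 0 → v = 0
  matNorm_one : ∀ x : V, matNorm 1 (Matrix.of fun _ _ => x) = ‖x‖
  matNorm_sandwich_le : ∀ (k l : ℕ) (α : Matrix (Fin l) (Fin k) ℂ)
    (v : Matrix (Fin k) (Fin k) V) (β : Matrix (Fin k) (Fin l) ℂ),
    matNorm l (scalarSandwich α v β) ≤ ‖α‖ * matNorm k v * ‖β‖
  matNorm_directSum : ∀ (k l : ℕ) (v : Matrix (Fin k) (Fin k) V)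
    (w : Matrix (Fin l) (Fin l) V),
    matNorm (k + l) (matrixDirectSum v w) = max (matNorm k v) (matNorm l w)

/-- The norm `‖Φ_k‖ ∈ [0, ∞]` of the amplification `Φ_k : M_k(V) → M_k(W)`, `[v_ij] ↦ [Φ(v_ij)]`. -/
def amplificationNorm {V W : Type*} [NormedAddCommGroup V] [NormedSpace ℂ V] [OperatorSpace V]
    [NormedAddCommGroup W] [NormedSpace ℂ W] [OperatorSpace W] (Φ : V →ₗ[ℂ] W) (k : ℕ) : ℝ≥0∞ :=
  ⨆ (v : Matrix (Fin k) (Fin k) V) (_ : OperatorSpace.matNorm k v ≤ 1),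
    ENNReal.ofReal (OperatorSpace.matNorm k (v.map Φ))

/-- The completely bounded norm `‖Φ‖_cb = sup_k ‖Φ_k‖ ∈ [0, ∞]`; it is finite exactly when `Φ` is
completely bounded. -/
def cbNorm {V W : Type*} [NormedAddCommGroup V] [NormedSpace ℂ V] [OperatorSpace V]
    [NormedAddCommGroup W] [NormedSpace ℂ W] [OperatorSpace W] (Φ : V →ₗ[ℂ] W) : ℝ≥0∞ :=
  ⨆ k : ℕ, amplificationNorm Φ k

/-! ### The operator space structure of the matrix algebra -/

theorem l2_sq_mulVec_le {m n : Type*} [Fintype m] [Fintype n] [DecidableEq n]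
    (A : Matrix m n ℂ) (x : n → ℂ) :
    ∑ i, ‖(A *ᵥ x) i‖ ^ 2 ≤ ‖A‖ ^ 2 * ∑ j, ‖x j‖ ^ 2 := by
  have h := Matrix.l2_opNorm_mulVec A (WithLp.toLp 2 x)
  have h2 := pow_le_pow_left₀ (norm_nonneg _) h 2
  rw [mul_pow, EuclideanSpace.norm_sq_eq, EuclideanSpace.norm_sq_eq] at h2
  simpa using h2

theorem l2_opNorm_le_of_sq {m n : Type*} [Fintype m] [Fintype n] [DecidableEq n]
    (A : Matrix m n ℂ) {C : ℝ} (hC : 0 ≤ C)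
    (h : ∀ x : n → ℂ, ∑ i, ‖(A *ᵥ x) i‖ ^ 2 ≤ C ^ 2 * ∑ j, ‖x j‖ ^ 2) : ‖A‖ ≤ C := by
  rw [Matrix.l2_opNorm_def]
  refine ContinuousLinearMap.opNorm_le_bound _ hC fun x => ?_
  refine le_of_sq_le_sq ?_ (by positivity)
  rw [mul_pow, EuclideanSpace.norm_sq_eq, EuclideanSpace.norm_sq_eq]
  simpa using h (WithLp.ofLp x)

theorem l2_opNorm_submatrix_le {m n m' n' : Type*} [Fintype m] [Fintype n] [DecidableEq n]
    [Fintype m'] [Fintype n'] [DecidableEq n'] (A : Matrix m n ℂ)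
    {f : m' → m} {g : n' → n} (hf : Function.Injective f) (hg : Function.Injective g) :
    ‖A.submatrix f g‖ ≤ ‖A‖ := by
  classical
  refine l2_opNorm_le_of_sq _ (norm_nonneg _) fun x => ?_
  have hx : ∀ j, Function.extend g x 0 (g j) = x j := fun j => hg.extend_apply _ _ _
  have key : ∀ (F : n → ℂ → ℂ), (∀ j, F j 0 = 0) →
      ∑ j, F j (Function.extend g x 0 j) = ∑ j', F (g j') (x j') := by
    intro F hF
    rw [← Finset.sum_subset (Finset.subset_univ (Finset.univ.map ⟨g, hg⟩))]
    · simp [hx]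
    · intro j _ hj
      rw [Function.extend_apply' _ _ _ (by simpa using hj)]
      exact hF j
  have key2 : ∑ j, ‖Function.extend g x 0 j‖ ^ 2 = ∑ j', ‖x j'‖ ^ 2 := by
    have := key (fun _ z => ((‖z‖ ^ 2 : ℝ) : ℂ)) (by simp)
    exact_mod_cast this
  have h1 := l2_sq_mulVec_le A (Function.extend g x 0)
  rw [key2] at h1
  refine le_trans ?_ h1
  have h2 : ∀ i, (A.submatrix f g *ᵥ x) i = (A *ᵥ Function.extend g x 0) (f i) := by
    intro i
    simp only [Matrix.mulVec, dotProduct, Matrix.submatrix_apply]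
    exact (key (fun j z => A (f i) j * z) (by simp)).symm
  simp only [h2]
  refine (Finset.sum_map Finset.univ ⟨f, hf⟩
    (fun i => ‖(A *ᵥ Function.extend g x 0) i‖ ^ 2)).symm.trans_le ?_
  exact Finset.sum_le_sum_of_subset_of_nonneg (Finset.subset_univ _) fun _ _ _ => by positivity

theorem l2_opNorm_submatrix_equiv {m n m' n' : Type*} [Fintype m] [Fintype n] [DecidableEq n]
    [Fintype m'] [Fintype n'] [DecidableEq n'] (A : Matrix m n ℂ) (e : m' ≃ m) (f : n' ≃ n) :
    ‖A.submatrix e f‖ = ‖A‖ := by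
  refine le_antisymm (l2_opNorm_submatrix_le A e.injective f.injective) ?_
  have h := l2_opNorm_submatrix_le (A.submatrix e f) e.symm.injective f.symm.injective
  simpa [Matrix.submatrix_submatrix] using h

theorem l2_opNorm_fromBlocks_diagonal {m n m' n' : Type*} [Fintype m] [Fintype n] [DecidableEq n]
    [Fintype m'] [Fintype n'] [DecidableEq n'] (A : Matrix m n ℂ) (D : Matrix m' n' ℂ) :
    ‖Matrix.fromBlocks A 0 0 D‖ = max ‖A‖ ‖D‖ := by
  refine le_antisymm ?_ (max_le ?_ ?_)
  · refine l2_opNorm_le_of_sq _ (by positivity) fun x => ?_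
    have hA := l2_sq_mulVec_le A (x ∘ Sum.inl)
    have hD := l2_sq_mulVec_le D (x ∘ Sum.inr)
    have h1 : ‖A‖ ^ 2 ≤ max ‖A‖ ‖D‖ ^ 2 := by gcongr; exact le_max_left _ _
    have h2 : ‖D‖ ^ 2 ≤ max ‖A‖ ‖D‖ ^ 2 := by gcongr; exact le_max_right _ _
    rw [Fintype.sum_sum_type, Fintype.sum_sum_type, mul_add]
    simp only [Matrix.fromBlocks_mulVec, Sum.elim_inl, Sum.elim_inr, Matrix.zero_mulVec, add_zero,
      zero_add]
    refine add_le_add (hA.trans ?_) (hD.trans ?_)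
    · exact mul_le_mul_of_nonneg_right h1 (Finset.sum_nonneg fun _ _ => by positivity)
    · exact mul_le_mul_of_nonneg_right h2 (Finset.sum_nonneg fun _ _ => by positivity)
  · exact l2_opNorm_submatrix_le (Matrix.fromBlocks A 0 0 D) (f := Sum.inl) (g := Sum.inl)
      Sum.inl_injective Sum.inl_injective
  · exact l2_opNorm_submatrix_le (Matrix.fromBlocks A 0 0 D) (f := Sum.inr) (g := Sum.inr)
      Sum.inr_injective Sum.inr_injective

theorem l2_opNorm_kronecker_one_le {m n o : Type*} [Fintype m] [Fintype n] [DecidableEq n]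
    [Fintype o] [DecidableEq o] (A : Matrix m n ℂ) :
    ‖Matrix.kroneckerMap (fun a b => a * b) A (1 : Matrix o o ℂ)‖ ≤ ‖A‖ := by
  refine l2_opNorm_le_of_sq _ (norm_nonneg _) fun x => ?_
  have h : ∀ i b, (Matrix.kroneckerMap (fun a b => a * b) A (1 : Matrix o o ℂ) *ᵥ x) (i, b)
      = (A *ᵥ fun j => x (j, b)) i := by
    intro i b
    simp [Matrix.mulVec, dotProduct, Fintype.sum_prod_type, Matrix.one_apply]
  rw [Fintype.sum_prod_type_right, Fintype.sum_prod_type_right, Finset.mul_sum]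
  refine Finset.sum_le_sum fun b _ => ?_
  simp only [h]
  exact l2_sq_mulVec_le A _

/-- The canonical operator space structure of the matrix algebra `M_n`: the norm of `M_k(M_n)` is the
operator norm on `ℂ^k ⊗ ℂ^n`, under the identification `M_k(M_n) = M_{kn}` by blocks. -/
instance matrixOperatorSpace (n : ℕ) : OperatorSpace (Matrix (Fin n) (Fin n) ℂ) where
  matNorm k v := ‖Matrix.comp (Fin k) (Fin k) (Fin n) (Fin n) ℂ v‖
  matNorm_add_le k v w := norm_add_le _ _
  matNorm_smul k c v := norm_smul c (Matrix.comp (Fin k) (Fin k) (Fin n) (Fin n) ℂ v)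
  eq_zero_of_matNorm_eq_zero k v h := by
    rw [norm_eq_zero] at h
    ext i j a b
    exact congrFun (congrFun h (i, a)) (j, b)
  matNorm_one x :=
    l2_opNorm_submatrix_equiv x (Equiv.uniqueProd (Fin n) (Fin 1)) (Equiv.uniqueProd (Fin n) (Fin 1))
  matNorm_sandwich_le k l α v β := by
    have h : Matrix.comp (Fin l) (Fin l) (Fin n) (Fin n) ℂ (scalarSandwich α v β)
        = Matrix.kroneckerMap (fun a b => a * b) α (1 : Matrix (Fin n) (Fin n) ℂ)
          * Matrix.comp (Fin k) (Fin k) (Fin n) (Fin n) ℂ v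
          * Matrix.kroneckerMap (fun a b => a * b) β (1 : Matrix (Fin n) (Fin n) ℂ) := by
      ext ⟨i, a⟩ ⟨j, b⟩
      simp only [scalarSandwich, Matrix.comp_apply, Matrix.of_apply, Matrix.mul_apply,
        Fintype.sum_prod_type, Matrix.kroneckerMap_apply, Matrix.one_apply, Matrix.sum_apply,
        Matrix.smul_apply, smul_eq_mul, mul_ite, mul_one, mul_zero, ite_mul, zero_mul,
        Finset.sum_ite_eq, Finset.sum_ite_eq', Finset.mem_univ, if_true]
      rw [Finset.sum_comm]
      refine Finset.sum_congr rfl fun q _ => ?_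
      rw [Finset.sum_mul]
      exact Finset.sum_congr rfl fun p _ => by ring
    rw [h]
    refine (Matrix.l2_opNorm_mul _ _).trans ?_
    refine mul_le_mul ((Matrix.l2_opNorm_mul _ _).trans ?_) (l2_opNorm_kronecker_one_le β)
      (norm_nonneg _) (by positivity)
    exact mul_le_mul_of_nonneg_right (l2_opNorm_kronecker_one_le α) (norm_nonneg _)
  matNorm_directSum k l v w := by
    rw [← l2_opNorm_fromBlocks_diagonal, ← l2_opNorm_submatrix_equiv
      (Matrix.comp (Fin (k + l)) (Fin (k + l)) (Fin n) (Fin n) ℂ (matrixDirectSum v w))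
      ((Equiv.sumProdDistrib (Fin k) (Fin l) (Fin n)).symm.trans
        (finSumFinEquiv.prodCongr (Equiv.refl (Fin n))))
      ((Equiv.sumProdDistrib (Fin k) (Fin l) (Fin n)).symm.trans
        (finSumFinEquiv.prodCongr (Equiv.refl (Fin n))))]
    congr 1
    ext (⟨i, a⟩ | ⟨i, a⟩) (⟨j, b⟩ | ⟨j, b⟩) <;> simp [matrixDirectSum, Matrix.comp_apply]

end

open scoped Matrix ENNReal Matrix.Norms.L2Operator

namespace OperatorSpace

variable {V : Type*} [NormedAddCommGroup V] [NormedSpace ℂ V] [OperatorSpace V]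

/-! `M_n` is spanned by n² Weyl-type unitaries U_g, a cyclic shift times a unimodular diagonal, g =
(shift, row of a complex Hadamard matrix F), orthogonal for the trace inner product. Write M = ∑
c_g(M) U_g. Then Φ_k(v) = R D C, where R has entries c_g(v_ir) in row i and column (r, g), D is
diagonal with entries Φ(U_g), and C stacks n² copies of the identity. By Ruan's axioms ‖Φ_k(v)‖ ≤
‖R‖ ‖D‖ ‖C‖, with ‖D‖ ≤ ‖Φ‖ and ‖C‖ ≤ √(n²) = n. Parseval for the U_g gives ‖R‖ ≤ ‖v‖
(`norm_shiftCoeff_row_le`), so the only loss is the factor n from C. -/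

theorem matNorm_zero (k : ℕ) : matNorm k (0 : Matrix (Fin k) (Fin k) V) = 0 := by
  simpa using matNorm_smul k (0 : ℂ) (0 : Matrix (Fin k) (Fin k) V)

/-- A diagonal matrix over an operator space is bounded by its largest entry. -/
theorem matNorm_diagonal_le {m : ℕ} (d : Fin m → V) {C : ℝ} (hC : 0 ≤ C) (hd : ∀ i, ‖d i‖ ≤ C) :
    matNorm m (Matrix.diagonal d) ≤ C := by
  induction m with
  -- The empty diagonal has norm 0; only here is `hC` needed.
  | zero => rwa [Subsingleton.elim (Matrix.diagonal d) 0, matNorm_zero]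
  | succ m ih =>
    have h : Matrix.diagonal d = matrixDirectSum (Matrix.diagonal fun i : Fin m => d i.castSucc)
        (Matrix.of fun _ _ : Fin 1 => d (Fin.last m)) := by
      ext i j
      refine Fin.lastCases ?_ (fun i => ?_) i <;> refine Fin.lastCases ?_ (fun j => ?_) j
      · simp [matrixDirectSum]
      · simpa [matrixDirectSum, Matrix.diagonal_apply, Fin.castSucc] using
          fun h => absurd h.symm (Fin.castSucc_ne_last j)
      · simpa [matrixDirectSum, Matrix.diagonal_apply, Fin.castSucc] using
          fun h => absurd h (Fin.castSucc_ne_last i)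
      · simp [matrixDirectSum, Matrix.diagonal_apply, Fin.castSucc]
    rw [h, matNorm_directSum, matNorm_one]
    exact max_le (ih _ fun i => hd _) (hd _)

/-- The norm of the product of a scalar row, a diagonal over an operator space, and a scalar
column. -/
theorem matNorm_sum_mul_smul_le {ι : Type*} [Fintype ι] [DecidableEq ι] {l : ℕ}
    (α : Matrix (Fin l) ι ℂ) (d : ι → V) (β : Matrix ι (Fin l) ℂ) {C : ℝ} (hC : 0 ≤ C)
    (hd : ∀ p, ‖d p‖ ≤ C) :
    matNorm l (Matrix.of fun i j => ∑ p, (α i p * β p j) • d p) ≤ ‖α‖ * C * ‖β‖ := by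
  let e := (Fintype.equivFin ι).symm
  have h := matNorm_sandwich_le _ l (α.submatrix (Equiv.refl _) e)
    (Matrix.diagonal fun i => d (e i)) (β.submatrix e (Equiv.refl _))
  rw [l2_opNorm_submatrix_equiv, l2_opNorm_submatrix_equiv] at h
  have hs : (Matrix.of fun i j => ∑ p, (α i p * β p j) • d p) =
      scalarSandwich (α.submatrix (Equiv.refl _) e)
        (Matrix.diagonal fun i => d (e i)) (β.submatrix e (Equiv.refl _)) := by
    ext i j
    simp only [scalarSandwich, Matrix.of_apply, Matrix.diagonal_apply, smul_ite, smul_zero,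
      Finset.sum_ite_eq, Finset.mem_univ, if_true, Matrix.submatrix_apply, Equiv.refl_apply]
    exact (e.sum_comp fun p => (α i p * β p j) • d p).symm
  rw [hs]
  refine h.trans ?_
  have := matNorm_diagonal_le (fun i => d (e i)) hC fun i => hd _
  gcongr

end OperatorSpace

/-! ### Weyl-type unitaries and their Parseval identity -/

/-- The character table of ℤ/n works, by orthogonality of characters. -/
theorem exists_unimodular_hadamard (n : ℕ) [NeZero n] :
    ∃ F : Matrix (Fin n) (Fin n) ℂ, (∀ i j, ‖F i j‖ = 1) ∧ Fᴴ * F = (n : ℂ) • 1 := by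
  let e := (ZMod.finEquiv n).toEquiv
  refine ⟨Matrix.of fun i j => ZMod.stdAddChar (e i * e j), fun i j => ?_, ?_⟩
  · exact AddChar.norm_apply (ZMod.stdAddChar (N := n)) (e i * e j)
  ext i j
  have h := AddChar.sum_mulShift (e j - e i) (ZMod.isPrimitive_stdAddChar n)
  simp only [sub_eq_zero, e.injective.eq_iff, ZMod.card] at h
  simp only [Matrix.mul_apply, Matrix.conjTranspose_apply, Matrix.of_apply, Matrix.smul_apply,
    Matrix.one_apply, smul_eq_mul, mul_ite, mul_one, mul_zero]
  rw [show (∑ x, star (ZMod.stdAddChar (e x * e i)) * ZMod.stdAddChar (e x * e j)) =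
    ∑ x, (ZMod.stdAddChar (x * (e j - e i)) : ℂ) from ?_, h]
  · simp [eq_comm]
  · rw [← e.sum_comp]
    refine Finset.sum_congr rfl fun x _ => ?_
    rw [mul_sub, sub_eq_add_neg, AddChar.map_add_eq_mul, AddChar.map_neg_eq_conj, mul_comm]
    rfl

section Weyl

variable {n : ℕ} [NeZero n]

/-- The shift by `s` composed with the diagonal given by the row `c` of `F`. -/
def shiftDiagonal (F : Matrix (Fin n) (Fin n) ℂ) (g : Fin n × Fin n) :
    Matrix (Fin n) (Fin n) ℂ :=
  Matrix.of fun a b => if b = a - g.1 then F g.2 b else 0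

/-- The coefficient of `M` along `shiftDiagonal F g`. -/
noncomputable def shiftCoeff (F M : Matrix (Fin n) (Fin n) ℂ) (g : Fin n × Fin n) : ℂ :=
  (n : ℂ)⁻¹ * ∑ j, star (F g.2 j) * M (j + g.1) j

/-- The matrix permutes coordinates and multiplies them by unimodular scalars, so it is isometric.
-/
theorem norm_shiftDiagonal_le {F : Matrix (Fin n) (Fin n) ℂ} (hF : ∀ i j, ‖F i j‖ = 1)
    (g : Fin n × Fin n) : ‖shiftDiagonal F g‖ ≤ 1 := by
  refine l2_opNorm_le_of_sq _ zero_le_one fun x => ?_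
  have h : ∀ a, (shiftDiagonal F g *ᵥ x) a = F g.2 (a - g.1) * x (a - g.1) := by
    intro a
    simp [shiftDiagonal, Matrix.mulVec, dotProduct]
  simp only [h, norm_mul, hF, one_mul, one_pow]
  exact ((Equiv.subRight g.1).sum_comp fun a => ‖x a‖ ^ 2).le

/-- Only the shift a - b contributes to entry (a, b); on that cyclic diagonal the sum over rows of F
is Fourier inversion. -/
theorem sum_shiftCoeff_smul {F : Matrix (Fin n) (Fin n) ℂ} (hF : Fᴴ * F = (n : ℂ) • 1)
    (M : Matrix (Fin n) (Fin n) ℂ) : ∑ g, shiftCoeff F M g • shiftDiagonal F g = M := by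
  have hn : (n : ℂ) ≠ 0 := Nat.cast_ne_zero.2 (NeZero.ne n)
  ext a b
  have h : ∀ j, ∑ c, star (F c j) * F c b = if j = b then (n : ℂ) else 0 := fun j => by
    simpa [Matrix.mul_apply, Matrix.one_apply] using congrFun (congrFun hF j) b
  have hb : ∀ s, b = a - s ↔ s = a - b := fun s =>
    ⟨fun h => by rw [h, sub_sub_cancel], fun h => by rw [h, sub_sub_cancel]⟩
  simp only [Matrix.sum_apply, Matrix.smul_apply, shiftDiagonal, Matrix.of_apply, smul_eq_mul,
    Fintype.sum_prod_type_right, hb, mul_ite, mul_zero, Finset.sum_ite_eq', Finset.mem_univ,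
    if_true, shiftCoeff, mul_assoc, Finset.sum_mul]
  rw [← Finset.mul_sum, Finset.sum_comm]
  have : ∀ j, ∑ c, star (F c j) * (M (j + (a - b)) j * F c b) =
      M (j + (a - b)) j * if j = b then (n : ℂ) else 0 := fun j => by
    rw [← h, Finset.mul_sum]
    exact Finset.sum_congr rfl fun c _ => by ring
  simp only [this, mul_ite, mul_zero, Finset.sum_ite_eq', Finset.mem_univ, if_true]
  rw [add_sub_cancel]
  field_simp

theorem sum_sq_norm_star_mulVec {F : Matrix (Fin n) (Fin n) ℂ} (hF : Fᴴ * F = (n : ℂ) • 1)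
    (w : Fin n → ℂ) : ∑ c, ‖∑ j, star (F c j) * w j‖ ^ 2 = n * ∑ j, ‖w j‖ ^ 2 := by
  have hn : (n : ℂ) ≠ 0 := Nat.cast_ne_zero.2 (NeZero.ne n)
  have hF' : F * Fᴴ = (n : ℂ) • 1 := by
    have h1 : ((n : ℂ)⁻¹ • Fᴴ) * F = 1 := by
      rw [Matrix.smul_mul, hF, smul_smul, inv_mul_cancel₀ hn, one_smul]
    have h2 := mul_eq_one_comm.1 h1
    rw [Matrix.mul_smul] at h2
    rw [← h2, smul_smul, mul_inv_cancel₀ hn, one_smul]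
  have key : star ((F.map star) *ᵥ w) ⬝ᵥ ((F.map star) *ᵥ w) = n * (star w ⬝ᵥ w) := by
    have hG : (F.map star)ᴴ * F.map star = (n : ℂ) • 1 := by
      have := congrArg Matrix.transpose hF
      rw [Matrix.transpose_mul] at this
      rw [Matrix.transpose_smul, Matrix.transpose_one] at this
      rw [← this]
      congr 1
      ext i j
      simp
    rw [Matrix.star_mulVec, ← Matrix.dotProduct_mulVec, Matrix.mulVec_mulVec, hG,
      Matrix.smul_mulVec, Matrix.one_mulVec, dotProduct_smul, smul_eq_mul]
  have hs : ∀ v : Fin n → ℂ, star v ⬝ᵥ v = ((∑ j, ‖v j‖ ^ 2 : ℝ) : ℂ) := fun v => by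
    simp [dotProduct, Complex.conj_mul']
  rw [hs, hs] at key
  exact_mod_cast key

/-- For each shift, the coefficients are n⁻¹ times the transform by conjugated F of one cyclic
diagonal, and these diagonals partition the entries of M. -/
theorem sum_sq_norm_shiftCoeff {F : Matrix (Fin n) (Fin n) ℂ} (hF : Fᴴ * F = (n : ℂ) • 1)
    (M : Matrix (Fin n) (Fin n) ℂ) :
    n * ∑ g, ‖shiftCoeff F M g‖ ^ 2 = ∑ a, ∑ b, ‖M a b‖ ^ 2 := by
  have hn : (n : ℝ) ≠ 0 := Nat.cast_ne_zero.2 (NeZero.ne n)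
  have hs : ∀ s, ∑ c, ‖shiftCoeff F M (s, c)‖ ^ 2 = (n : ℝ)⁻¹ * ∑ j, ‖M (j + s) j‖ ^ 2 := by
    intro s
    simp only [shiftCoeff, norm_mul, mul_pow, ← Finset.mul_sum]
    rw [sum_sq_norm_star_mulVec hF fun j => M (j + s) j, norm_inv, Complex.norm_natCast]
    field_simp
  rw [Fintype.sum_prod_type]
  simp only [hs]
  rw [← Finset.mul_sum, mul_inv_cancel_left₀ hn, Finset.sum_comm,
    Finset.sum_comm (f := fun a b => ‖M a b‖ ^ 2)]
  refine Finset.sum_congr rfl fun j _ => ?_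
  exact Equiv.sum_comp (Equiv.addLeft j) fun a => ‖M a j‖ ^ 2

/-- The row of the coefficients of a matrix over `M_n` is a contractive image of that matrix. -/
theorem norm_shiftCoeff_row_le {F : Matrix (Fin n) (Fin n) ℂ} (hF : Fᴴ * F = (n : ℂ) • 1) {k : ℕ}
    (v : Matrix (Fin k) (Fin k) (Matrix (Fin n) (Fin n) ℂ)) :
    ‖Matrix.of fun (i : Fin k) (p : Fin k × Fin n × Fin n) => shiftCoeff F (v i p.1) p.2‖ ≤
      ‖Matrix.comp (Fin k) (Fin k) (Fin n) (Fin n) ℂ v‖ := by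
  have hn : (0 : ℝ) < n := Nat.cast_pos.2 (NeZero.pos n)
  set X := Matrix.comp (Fin k) (Fin k) (Fin n) (Fin n) ℂ v with hX
  rw [← Matrix.l2_opNorm_conjTranspose]
  refine l2_opNorm_le_of_sq _ (norm_nonneg _) fun y => ?_
  -- By linearity of c_g, the adjoint row applied to y has entries conjugate to c_g(M_r).
  let M : Fin k → Matrix (Fin n) (Fin n) ℂ := fun r => ∑ i, star (y i) • v i r
  have h1 : ∀ r g, ‖((Matrix.of fun (i : Fin k) (p : Fin k × Fin n × Fin n) =>
      shiftCoeff F (v i p.1) p.2)ᴴ *ᵥ y) (r, g)‖ = ‖shiftCoeff F (M r) g‖ := by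
    intro r g
    rw [← norm_star (shiftCoeff F (M r) g)]
    congr 1
    simp only [Matrix.mulVec, dotProduct, Matrix.conjTranspose_apply, Matrix.of_apply, shiftCoeff,
      M, Matrix.sum_apply, Matrix.smul_apply, smul_eq_mul, star_mul', star_sum, star_star,
      Finset.mul_sum, Finset.sum_mul]
    rw [Finset.sum_comm]
    exact Finset.sum_congr rfl fun _ _ => Finset.sum_congr rfl fun _ _ => by ring
  -- Row a of the M_r is, up to conjugation, X* applied to y ⊗ e_a.
  have h2 : ∀ a, ∑ r, ∑ b, ‖M r a b‖ ^ 2 ≤ ‖X‖ ^ 2 * ∑ i, ‖y i‖ ^ 2 := by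
    intro a
    have h := l2_sq_mulVec_le Xᴴ fun q : Fin k × Fin n => if q.2 = a then y q.1 else 0
    rw [Matrix.l2_opNorm_conjTranspose, Fintype.sum_prod_type, Fintype.sum_prod_type] at h
    refine (le_of_eq ?_).trans (h.trans (le_of_eq ?_))
    · refine Finset.sum_congr rfl fun r _ => Finset.sum_congr rfl fun b _ => ?_
      rw [← norm_star (M r a b)]
      simp [Matrix.mulVec, dotProduct, Fintype.sum_prod_type, M, Matrix.sum_apply, hX, mul_comm,
        Matrix.comp_apply]
    · congr 1
      refine Finset.sum_congr rfl fun i _ => ?_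
      rw [Finset.sum_eq_single a] <;> simp +contextual
  rw [Fintype.sum_prod_type]
  simp only [h1]
  -- Parseval's factor n cancels against the n rows a, each bounded by `h2`.
  refine le_of_mul_le_mul_left ?_ hn
  rw [Finset.mul_sum]
  simp only [sum_sq_norm_shiftCoeff hF]
  rw [Finset.sum_comm]
  refine (Finset.sum_le_sum fun a _ => h2 a).trans ?_
  simp

end Weyl

/-! ### Factorization and the final estimate -/

/-- A vector is sent to `card ι` copies of itself, so its squared length grows by exactly that
factor. -/
theorem norm_repeated_one_le (k : ℕ) {ι : Type*} [Fintype ι] [DecidableEq ι] {C : ℝ} (hC : 0 ≤ C)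
    (h : (Fintype.card ι : ℝ) ≤ C ^ 2) :
    ‖Matrix.of fun (p : Fin k × ι) (j : Fin k) => (1 : Matrix (Fin k) (Fin k) ℂ) p.1 j‖ ≤ C := by
  refine l2_opNorm_le_of_sq _ hC fun x => ?_
  have hx : ∀ p : Fin k × ι, ((Matrix.of fun (p : Fin k × ι) (j : Fin k) =>
      (1 : Matrix (Fin k) (Fin k) ℂ) p.1 j) *ᵥ x) p = x p.1 := fun p =>
    congrFun (Matrix.one_mulVec x) p.1
  simp only [hx, Fintype.sum_prod_type, Finset.sum_const, Finset.card_univ, nsmul_eq_mul]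
  rw [← Finset.mul_sum]
  gcongr

theorem matNorm_map_le {n : ℕ} {V : Type*} [NormedAddCommGroup V] [NormedSpace ℂ V]
    [OperatorSpace V] (Φ : Matrix (Fin n) (Fin n) ℂ →ₗ[ℂ] V) {k : ℕ}
    (v : Matrix (Fin k) (Fin k) (Matrix (Fin n) (Fin n) ℂ)) :
    OperatorSpace.matNorm k (v.map Φ) ≤
      OperatorSpace.matNorm k v * ‖LinearMap.toContinuousLinearMap Φ‖ * n := by
  -- Cyclic shifts need n > 0; for n = 0 the domain is trivial.
  rcases Nat.eq_zero_or_pos n with rfl | hn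
  · have h : v.map Φ = 0 := by
      ext i j
      rw [Matrix.map_apply, Subsingleton.elim (v i j) 0, map_zero, Matrix.zero_apply]
    rw [h, OperatorSpace.matNorm_zero]
    simp
  have : NeZero n := ⟨hn.ne'⟩
  obtain ⟨F, hF1, hF⟩ := exists_unimodular_hadamard n
  have hd : ∀ p : Fin k × Fin n × Fin n,
      ‖Φ (shiftDiagonal F p.2)‖ ≤ ‖LinearMap.toContinuousLinearMap Φ‖ := fun p =>
    ((LinearMap.toContinuousLinearMap Φ).le_opNorm (shiftDiagonal F p.2)).trans <|
      mul_le_of_le_one_right (norm_nonneg _) (norm_shiftDiagonal_le hF1 _)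
  have h := OperatorSpace.matNorm_sum_mul_smul_le
    (Matrix.of fun (i : Fin k) (p : Fin k × Fin n × Fin n) => shiftCoeff F (v i p.1) p.2)
    (fun p => Φ (shiftDiagonal F p.2))
    (Matrix.of fun (p : Fin k × Fin n × Fin n) (j : Fin k) =>
      (1 : Matrix (Fin k) (Fin k) ℂ) p.1 j) (norm_nonneg _) hd
  -- The factorization R D C: the stacked identity keeps only the terms with r = j.
  have hv : v.map Φ = Matrix.of fun i j => ∑ p : Fin k × Fin n × Fin n,
      ((Matrix.of fun (i : Fin k) (p : Fin k × Fin n × Fin n) => shiftCoeff F (v i p.1) p.2) i p *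
      (Matrix.of fun (p : Fin k × Fin n × Fin n) (j : Fin k) =>
        (1 : Matrix (Fin k) (Fin k) ℂ) p.1 j) p j) • Φ (shiftDiagonal F p.2) := by
    ext i j
    have h0 : Φ (v i j) = ∑ g, shiftCoeff F (v i j) g • Φ (shiftDiagonal F g) := by
      conv_lhs => rw [← sum_shiftCoeff_smul hF (v i j), map_sum]
      simp only [map_smul]
    rw [Matrix.map_apply, Matrix.of_apply, Fintype.sum_prod_type_right, h0]
    refine Finset.sum_congr rfl fun g _ => ?_
    simp [Matrix.one_apply]
  rw [hv]
  refine h.trans ?_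
  have h1 := norm_shiftCoeff_row_le hF v
  have h2 := norm_repeated_one_le k (ι := Fin n × Fin n) (C := n) (by positivity) (by simp [sq])
  exact mul_le_mul (mul_le_mul_of_nonneg_right h1 (norm_nonneg _)) h2 (norm_nonneg _)
    (mul_nonneg (norm_nonneg _) (norm_nonneg _))

theorem mainTheorem6 (n : ℕ) {V : Type*} [NormedAddCommGroup V] [NormedSpace ℂ V]
    [OperatorSpace V] (Φ : Matrix (Fin n) (Fin n) ℂ →ₗ[ℂ] V) :
    cbNorm Φ ≤ n * ‖LinearMap.toContinuousLinearMap Φ‖ₑ := by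
  refine iSup_le fun k => iSup_le fun v => iSup_le fun hv => ?_
  rw [← ofReal_norm, ← ENNReal.ofReal_natCast, ← ENNReal.ofReal_mul (Nat.cast_nonneg n)]
  refine ENNReal.ofReal_le_ofReal ((matNorm_map_le Φ v).trans ?_)
  rw [mul_comm (n : ℝ)]
  gcongr
  exact mul_le_of_le_one_left (norm_nonneg _) hv
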